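/- Let $\mathscr P$ be a finite set of processes and let $\Sigma$ be a finite alphabet with a location function $\mathrm{loc}\colon\Sigma\to 2^{\mathscr P}\setminus\{\emptyset\}$. For a trace $t$ over $(\Sigma,\mathrm{loc})$, an event $e$ of $t$ and $i\in\mathscr P$, let ${\Downarrow}e$ be the set of events strictly below $e$, and let $e_i$ be the last event of process $i$ in ${\Downarrow}e$, if there is one. Let $\Gamma=\{0,1\}^{\mathscr P\times\mathscr P}$, and let $\theta^{Y}$ be the labelling function that adds to each event $e$ of a trace the label $\gamma\in\Gamma$ with $\gamma_{i,j}=1$ if and only if $e_i$ and $e_j$ exist and $e_i\le e_j$. An asynchronous transducer (an asynchronous automaton $T$ with output functions $\mu_a$ on its $a$-states) computes a labelling function if on every trace it outputs the label of each event $e$, where its output at an event $e$ with letter $a$ is $\mu_a(s_a)$ and $s=T({\Downarrow}e)$ is the global state reached on ${\Downarrow}e$. For an asynchronous automaton $A$ with set of global states $S_A$, the global-state labelling function $\zeta_A$ adds to each event $e$ the global state $A({\Downarrow}e)$. A global cascade sequence $A_{\mathrm{seq}}=(A_1,\dots,A_n)$, $n\ge 1$, over $\Sigma$ consists of asynchronous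 automata such that $A_p$ has the input alphabet $\Sigma\times S_{A_1}\times\dots\times S_{A_{p-1}}$, with locations inherited from $\Sigma$; let $\zeta_{A_{\mathrm{seq}}}(t)=\zeta_{A_n}(\cdots\zeta_{A_1}(t)\cdots)$. There is an asynchronous transducer $\mathcal G$ over $\Sigma$ that computes $\theta^{Y}$. For every asynchronous transducer $\mathcal G$ that computes $\theta^{Y}$ (with local states $\Upsilon_i$, transitions $\nabla_a$ and outputs $\nu_a\colon\Upsilon_a\to\Gamma$) and every global cascade sequence $A_{\mathrm{seq}}=(A_1,\dots,A_n)$ over $\Sigma$, the following transducer computes $\zeta_{A_{\mathrm{seq}}}$. Its local states for process $i$ are the tuples $(\upsilon,q_1,\dots,q_n)\in\Upsilon_i\times S_{A_1}\times\dots\times S_{A_n}$, with all components initial at the start, each $q_p$ being initially the initial global state of $A_p$. For a letter $a$ and an $a$-state $(\upsilon_a,q_1,\dots,q_n)$, where now $\upsilon_a\in\Upsilon_a$ and $q_p\in S_{A_p}^{\mathrm{loc}(a)}$, put $\gamma=\nu_a(\upsilon_a)$ and let $g_p\in S_{A_p}$ be the global state with $g_p(i)=q_p(j)(i)$ for a $j\in\mathrm{loc}(a)$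 with $\gamma_{i,j}=1$ if such a $j$ exists, and with $g_p(i)$ the initial $i$-state of $A_p$ otherwise. The output is $(g_1,\dots,g_n)$, and the transition on $a$ maps $\upsilon_a$ to $\nabla_a(\upsilon_a)$ and sets each $q_p(i)$, $i\in\mathrm{loc}(a)$, to the global state that $A_p$ reaches from $g_p$ on the letter $(a,g_1,\dots,g_{p-1})$. In particular, $\zeta_{A_{\mathrm{seq}}}$ is computed by an asynchronous automaton. This automaton is the cascade product $\mathcal G\circ^r(A_1^g\circ_\ell\dots\circ_\ell A_n^g)$, where $A_p^g$ is the component that updates $q_p$. -/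

import Mathlib

universe u

/-- A distributed alphabet over the set of processes `P` with total alphabet `α`, given by its
location function: `loc a = {i | a ∈ Σ_i}`, that is `Σ_i = {a | i ∈ loc a}`.
Every letter lies in some `Σ_i`. -/
structure DistAlphabet (P α : Type u) where
  loc : α → Set P
  loc_nonempty : ∀ a, (loc a).Nonempty

namespace DistAlphabet

variable {P α : Type u}

/-- The dependence relation: `a` and `b` share a process. -/
def Dep (D : DistAlphabet P α) (a b : α) : Prop :=
  (D.loc a ∩ D.loc b).Nonempty

/-- The distributed alphabet `Σ × Γ`, with `loc (a, γ) = loc a`. -/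
def prod (D : DistAlphabet P α) (Γ : Type u) : DistAlphabet P (α × Γ) where
  loc x := D.loc x.1
  loc_nonempty x := D.loc_nonempty x.1

end DistAlphabet

/-- For a family `S` of local state sets and a set `Q` of processes, the set of `Q`-states. -/
abbrev LocalState {P : Type u} (S : P → Type u) (Q : Set P) : Type u :=
  (i : Q) → S i

/-- The restriction of a global state to the processes in `Q`. -/
def restrictState {P : Type u} {S : P → Type u} (Q : Set P) (s : (i : P) → S i) :
    LocalState S Q :=
  fun i => s i

open Classical in
/-- The extension to global states of a transformation of `Q`-states. -/
noncomputable def extendMap {P : Type u} {S : P → Type u} (Q : Set P)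
    (f : LocalState S Q → LocalState S Q) (s : (i : P) → S i) : (i : P) → S i :=
  fun i => if h : i ∈ Q then f (restrictState Q s) ⟨i, h⟩ else s i

/-- The distributed alphabet `Σ ×_ℓ S` of the pairs `(a, s_a)` of a letter `a` and an
`a`-state `s_a`, with `loc (a, s_a) = loc a`. -/
def DistAlphabet.lprod {P α : Type u} (D : DistAlphabet P α) (S : P → Type u) :
    DistAlphabet P ((a : α) × LocalState S (D.loc a)) where
  loc x := D.loc x.1
  loc_nonempty x := D.loc_nonempty x.1

/-- A trace over a distributed alphabet: a finite labelled poset in which events that are in the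
covering relation carry dependent letters, and events with dependent letters are comparable. -/
structure Trace {P α : Type u} (D : DistAlphabet P α) where
  E : Type u
  [finite : Finite E]
  [order : PartialOrder E]
  label : E → α
  dep_of_covBy : ∀ e f : E, e ⋖ f → D.Dep (label e) (label f)
  le_or_le_of_dep : ∀ e f : E, D.Dep (label e) (label f) → e ≤ f ∨ f ≤ e

attribute [instance] Trace.finite Trace.order

namespace Trace

variable {P α : Type u} {D : DistAlphabet P α}

/-- The prefix of a trace given by a downward closed set of events. -/
def restrict (t : Trace D) (c : LowerSet t.E) : Trace D where
  E := {e : t.E // e ∈ c}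
  label e := t.label e.1
  dep_of_covBy e f h := by
    refine t.dep_of_covBy e.1 f.1 ⟨h.1, fun g h₁ h₂ => ?_⟩
    exact h.2 (c := ⟨g, c.lower h₂.le f.2⟩) h₁ h₂
  le_or_le_of_dep e f h := t.le_or_le_of_dep e.1 f.1 h

/-- The strict past of the event `e`, as a trace. -/
def strictPast (t : Trace D) (e : t.E) : Trace D :=
  t.restrict (LowerSet.Iio e)

/-- The trace over `Σ × Γ` with the same events and order as `t`, in which the event `e` carries
the additional label `μ e`. -/
def addLabel (t : Trace D) {Γ : Type u} (μ : t.E → Γ) : Trace (D.prod Γ) where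
  E := t.E
  label e := (t.label e, μ e)
  dep_of_covBy := t.dep_of_covBy
  le_or_le_of_dep := t.le_or_le_of_dep

/-- `l` lists all events of `t`, each exactly once, in an order compatible with that of `t`. -/
def IsLinearization (t : Trace D) (l : List t.E) : Prop :=
  l.Pairwise (fun e f => ¬ f ≤ e) ∧ ∀ e, e ∈ l

theorem exists_isLinearization (t : Trace D) : ∃ l, t.IsLinearization l := by
  classical
  have : Finite (LinearExtension t.E) := t.finite
  have : Fintype (LinearExtension t.E) := Fintype.ofFinite _
  let l : List (LinearExtension t.E) := (Finset.univ : Finset (LinearExtension t.E)).sort (· ≤ ·)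
  have h₁ : l.Pairwise (· < ·) := Finset.sortedLT_sort _ |>.pairwise
  have h₂ : ∀ e, e ∈ l := fun e => (Finset.mem_sort _).2 (Finset.mem_univ e)
  refine ⟨l, h₁.imp fun {a b} hab hba => ?_, h₂⟩
  exact absurd ((toLinearExtension (α := t.E)).monotone hba) (not_le_of_gt hab)

/-- A chosen linearization of `t`. -/
noncomputable def linearization (t : Trace D) : List t.E :=
  t.exists_isLinearization.choose

theorem linearization_spec (t : Trace D) : t.IsLinearization t.linearization :=
  t.exists_isLinearization.choose_spec

end Trace

/-- An asynchronous automaton over a distributed alphabet: finite sets `S i` of local states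
(non-empty, since there is an initial state), local transition functions `δ a` on `a`-states,
and an initial global state. -/
structure AsyncAut {P α : Type u} (D : DistAlphabet P α) where
  S : P → Type u
  [finite : ∀ i, Finite (S i)]
  δ : (a : α) → LocalState S (D.loc a) → LocalState S (D.loc a)
  init : (i : P) → S i

attribute [instance] AsyncAut.finite

namespace AsyncAut

variable {P α : Type u} {D : DistAlphabet P α}

/-- The set of global states. -/
abbrev Global (A : AsyncAut D) : Type u := (i : P) → A.S i

/-- The global transition function `Δ_a`, the extension of `δ_a` to global states. -/
noncomputable def Δ (A : AsyncAut D) (a : α) : A.Global → A.Global :=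
  extendMap (D.loc a) (A.δ a)

/-- The global state reached from `s` on reading the events of the list `l` in their order. -/
noncomputable def runList (A : AsyncAut D) (t : Trace D) (l : List t.E) (s : A.Global) :
    A.Global :=
  l.foldl (fun s e => A.Δ (t.label e) s) s

/-- `A(t)`, the global state reached by `A` on the trace `t`. By `run_eq` below, it does not
depend on the linearization. -/
noncomputable def run (A : AsyncAut D) (t : Trace D) : A.Global :=
  A.runList t t.linearization A.init

theorem Δ_comm (A : AsyncAut D) (a b : α) (h : ¬ D.Dep a b) (s : A.Global) :
    A.Δ a (A.Δ b s) = A.Δ b (A.Δ a s) := by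
  have hab : ∀ i, i ∈ D.loc a → i ∉ D.loc b := fun i ha hb => h ⟨i, ha, hb⟩
  have hr : ∀ (Q R : Set P) (f : LocalState A.S R → LocalState A.S R) (s : A.Global),
      (∀ i, i ∈ Q → i ∉ R) → restrictState Q (extendMap R f s) = restrictState Q s := by
    intro Q R f s hQR
    funext i
    simp [restrictState, extendMap, hQR i.1 i.2]
  unfold Δ
  funext i
  by_cases ha : i ∈ D.loc a
  · have hb := hab i ha
    have := hr (D.loc a) (D.loc b) (A.δ b) s hab
    rw [extendMap, dif_pos ha, this, extendMap, dif_neg hb, extendMap, dif_pos ha]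
  · have := hr (D.loc b) (D.loc a) (A.δ a) s (fun i hb ha => hab i ha hb)
    rw [extendMap, dif_neg ha]
    by_cases hb : i ∈ D.loc b
    · rw [extendMap, dif_pos hb, extendMap, dif_pos hb, this]
    · rw [extendMap, dif_neg hb, extendMap, dif_neg hb, extendMap, dif_neg ha]

theorem runList_move (A : AsyncAut D) (t : Trace D) (e : t.E) (l : List t.E)
    (h : ∀ f ∈ l, ¬ D.Dep (t.label e) (t.label f)) (s : A.Global) :
    A.runList t (l ++ [e]) s = A.runList t (e :: l) s := by
  induction l generalizing s with
  | nil => rfl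
  | cons f l ih =>
    have h₁ := ih (fun g hg => h g (List.mem_cons_of_mem _ hg)) (A.Δ (t.label f) s)
    have h₂ := A.Δ_comm _ _ (h f List.mem_cons_self) s
    simp only [runList, List.cons_append, List.foldl_cons] at h₁ ⊢
    rw [h₁, h₂]

theorem runList_eq_of_perm (A : AsyncAut D) (t : Trace D) (l₁ l₂ : List t.E)
    (h₁ : l₁.Pairwise (fun e f => ¬ f ≤ e)) (h₂ : l₂.Pairwise (fun e f => ¬ f ≤ e))
    (hp : l₁.Perm l₂) (s : A.Global) : A.runList t l₁ s = A.runList t l₂ s := by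
  induction l₁ generalizing l₂ s with
  | nil => rw [hp.nil_eq]
  | cons e l ih =>
    obtain ⟨x, y, rfl⟩ := List.append_of_mem (hp.subset List.mem_cons_self)
    have hp' : l.Perm (x ++ y) :=
      (List.perm_cons e).1 (hp.trans List.perm_middle)
    have h₂' := List.pairwise_append.1 h₂
    have hind : ∀ f ∈ x, ¬ D.Dep (t.label e) (t.label f) := by
      intro f hf hd
      have h₃ : ¬ e ≤ f := h₂'.2.2 f hf e List.mem_cons_self
      have h₄ : ¬ f ≤ e :=
        (List.pairwise_cons.1 h₁).1 f (hp'.symm.subset (List.mem_append_left _ hf))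
      exact (t.le_or_le_of_dep e f hd).elim h₃ h₄
    have hxy : (x ++ y).Pairwise (fun e f => ¬ f ≤ e) :=
      List.pairwise_append.2 ⟨h₂'.1, (List.pairwise_cons.1 h₂'.2.1).2,
        fun a ha b hb => h₂'.2.2 a ha b (List.mem_cons_of_mem _ hb)⟩
    have h₅ := A.runList_move t e x hind s
    have h₆ := ih (x ++ y) (List.pairwise_cons.1 h₁).2 hxy hp' (A.Δ (t.label e) s)
    simp only [runList, List.foldl_append, List.foldl_cons, List.foldl_nil] at h₅ h₆ ⊢
    rw [h₅, h₆]

/-- The state `A(t)` can be computed along any linearization of `t`. -/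
theorem run_eq (A : AsyncAut D) (t : Trace D) (l : List t.E) (hl : t.IsLinearization l) :
    A.run t = A.runList t l A.init := by
  have hn : ∀ l : List t.E, l.Pairwise (fun e f => ¬ f ≤ e) → l.Nodup := fun l h =>
    h.imp fun {a b} hab heq => hab heq.ge
  have ht := t.linearization_spec
  refine A.runList_eq_of_perm t _ _ ht.1 hl.1 ?_ _
  exact (List.perm_ext_iff_of_nodup (hn _ ht.1) (hn _ hl.1)).2
    fun e => ⟨fun _ => hl.2 e, fun _ => ht.2 e⟩

end AsyncAut

/-- A `Γ`-labelling function, given by the labels that it adds to the events of each trace. -/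
abbrev Labelling {P α : Type u} (D : DistAlphabet P α) (Γ : Type u) : Type (u + 1) :=
  (t : Trace D) → t.E → Γ

namespace Labelling

variable {P α : Type u} {D : DistAlphabet P α} {Γ Γ₁ Γ₂ : Type u}

/-- The labelling function as a map from traces over `Σ` to traces over `Σ × Γ`. -/
def apply (θ : Labelling D Γ) (t : Trace D) : Trace (D.prod Γ) :=
  t.addLabel (θ t)

/-- The composition `t ↦ θ₂ (θ₁ t)` of labelling functions, where `(Σ × Γ₁) × Γ₂` is identified
with `Σ × (Γ₁ × Γ₂)`. -/
def comp (θ₁ : Labelling D Γ₁) (θ₂ : Labelling (D.prod Γ₁) Γ₂) : Labelling D (Γ₁ × Γ₂) :=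
  fun t e => (θ₁ t e, θ₂ (θ₁.apply t) e)

/-- Up to the identification of alphabets, `comp` is the composition of maps on traces. -/
theorem comp_apply_label (θ₁ : Labelling D Γ₁) (θ₂ : Labelling (D.prod Γ₁) Γ₂) (t : Trace D)
    (e : t.E) : ((θ₁.comp θ₂).apply t).label e =
      Equiv.prodAssoc α Γ₁ Γ₂ ((θ₂.apply (θ₁.apply t)).label e) := rfl

end Labelling

/-- An asynchronous letter-to-letter `Γ`-transducer: an asynchronous automaton with output
functions on `a`-states. -/
structure Transducer {P α : Type u} (D : DistAlphabet P α) (Γ : Type u) extends AsyncAut D where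
  out : (a : α) → LocalState S (D.loc a) → Γ

namespace Transducer

variable {P α : Type u} {D : DistAlphabet P α} {Γ : Type u}

/-- The labelling function of a transducer: an event `e` with letter `a` gets the output on
`s_a`, where `s` is the global state reached on the strict past of `e`. -/
noncomputable def labelling (T : Transducer D Γ) : Labelling D Γ :=
  fun t e => T.out (t.label e) (restrictState (D.loc (t.label e)) (T.run (t.strictPast e)))

/-- The transducer `T` computes the labelling function `θ`. -/
def Computes (T : Transducer D Γ) (θ : Labelling D Γ) : Prop :=
  ∀ t : Trace D, T.labelling.apply t = θ.apply t

end Transducer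

/-- The set `{0,1}^(P × P)` of truth values of the constants `Y_i ≤ Y_j`. -/
abbrev PrimaryLabel (P : Type u) : Type u := P × P → Bool

/-- `f` is the event `e_i`, the last event of process `i` in the strict past of `e`. -/
def Trace.IsPrimary {P α : Type u} {D : DistAlphabet P α} (t : Trace D) (e : t.E) (i : P)
    (f : t.E) : Prop :=
  IsGreatest {g : t.E | g < e ∧ i ∈ D.loc (t.label g)} f

open Classical in
/-- The primary order labelling function: the entry `(i, j)` of the label of `e` is `1` exactly
when `e_i` and `e_j` exist and `e_i ≤ e_j`. -/
noncomputable def primaryOrder {P α : Type u} (D : DistAlphabet P α) :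
    Labelling D (PrimaryLabel P) :=
  fun t e p => decide (∃ f g, t.IsPrimary e p.1 f ∧ t.IsPrimary e p.2 g ∧ f ≤ g)

/-- The global-state labelling function `ζ_A`: every event is decorated with the global state
reached by `A` on its strict past. -/
noncomputable def AsyncAut.globalLabelling {P α : Type u} {D : DistAlphabet P α}
    (A : AsyncAut D) : Labelling D A.Global :=
  fun t e => A.run (t.strictPast e)

/-- Non-empty global cascade sequences `(A_1, …, A_n)` with input alphabet `D`. The index is the
set `S_{A_1} × ⋯ × S_{A_n}` of global states of the sequence; the next automaton of the sequence
has the input alphabet `Σ × (S_{A_1} × ⋯ × S_{A_n})`. -/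
inductive GlobalCascadeSeq {P α : Type u} (D : DistAlphabet P α) : Type u → Type (u + 1)
  | single (A : AsyncAut D) : GlobalCascadeSeq D A.Global
  | snoc {Λ : Type u} (s : GlobalCascadeSeq D Λ) (A : AsyncAut (D.prod Λ)) :
      GlobalCascadeSeq D (Λ × A.Global)

/-- The composed global-state labelling function of a global cascade sequence. -/
noncomputable def GlobalCascadeSeq.globalLabelling {P α : Type u} {D : DistAlphabet P α} :
    {Λ : Type u} → GlobalCascadeSeq D Λ → Labelling D Λ
  | _, .single A => A.globalLabelling
  | _, .snoc s A => Labelling.comp s.globalLabelling A.globalLabelling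

/-- The local cascade product `A ∘_ℓ B`. -/
def AsyncAut.localCascade {P α : Type u} {D : DistAlphabet P α} (A : AsyncAut D)
    (B : AsyncAut (D.lprod A.S)) : AsyncAut D where
  S i := A.S i × B.S i
  δ a r i := (A.δ a (fun j => (r j).1) i,
    B.δ ⟨a, fun j => (r j).1⟩ (fun j => (r j).2) i)
  init i := (A.init i, B.init i)

/-- The restricted local cascade product `G ∘^r B`: the automaton `B` reads the letters of the
input together with the output of the transducer `G`. -/
def Transducer.restrictedCascade {P α : Type u} {D : DistAlphabet P α} {Γ : Type u}
    (G : Transducer D Γ) (B : AsyncAut (D.prod Γ)) : AsyncAut D where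
  S i := G.S i × B.S i
  δ a r i := (G.δ a (fun j => (r j).1) i,
    B.δ (a, G.out a (fun j => (r j).1)) (fun j => (r j).2) i)
  init i := (G.init i, B.init i)

open Classical in
/-- The best global state that the processes in `Q` are collectively aware of, when `q j` is the
best global state that process `j` is aware of: its `i`-component is taken from a process
`j ∈ Q` with `γ (i, j) = 1` (any choice will do) if there is one, and from the initial state
otherwise. -/
noncomputable def globalState {P : Type u} {S : P → Type u} (init : (i : P) → S i)
    (γ : PrimaryLabel P) {Q : Set P} (q : Q → (i : P) → S i) : (i : P) → S i :=
  fun i => if h : ∃ j : Q, γ (i, j) = true then q h.choose i else init i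

/-- The global-state detector `A^g` of an automaton `A` over `Σ`; it is the first component
`A_1^g` of the cascade of a sequence that starts with `A`. -/
noncomputable def AsyncAut.detector {P α : Type u} [Finite P] {D : DistAlphabet P α}
    (A : AsyncAut D) : AsyncAut (D.prod (PrimaryLabel P)) where
  S _ := A.Global
  δ x q := fun _ => A.Δ x.1 (globalState A.init x.2 q)
  init := fun _ => A.init

/-- The global-state detector `A_p^g` of a later component `A` of a sequence. Here `B` stands for
`A_1^g ∘_ℓ ⋯ ∘_ℓ A_{p-1}^g`, together with the output functions that yield the tuple of the best
global states of `A_1, …, A_{p-1}` that the participating processes are aware of. On the letter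
`((a, γ), q_a)`, the transition of `A` on `(a, tuple)` is applied to the best global state
of `A`. -/
noncomputable def AsyncAut.laterDetector {P α Λ : Type u} [Finite P] {D : DistAlphabet P α}
    (B : Transducer (D.prod (PrimaryLabel P)) Λ) (A : AsyncAut (D.prod Λ)) :
    AsyncAut ((D.prod (PrimaryLabel P)).lprod B.S) where
  S _ := A.Global
  δ x q := fun _ => A.Δ (x.1.1, B.out x.1 x.2) (globalState A.init x.1.2 q)
  init := fun _ => A.init

/-- The local cascade product `A_1^g ∘_ℓ ⋯ ∘_ℓ A_n^g` of the detectors of a sequence, with the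
output functions `(q_1, …, q_n) ↦ (globalstate_{(a,γ)}(q_1), …, globalstate_{(a,γ)}(q_n))`. -/
noncomputable def GlobalCascadeSeq.detectors {P α : Type u} [Finite P] {D : DistAlphabet P α} :
    {Λ : Type u} → GlobalCascadeSeq D Λ → Transducer (D.prod (PrimaryLabel P)) Λ
  | _, .single A =>
    { toAsyncAut := A.detector
      out := fun x q => globalState A.init x.2 q }
  | _, .snoc s A =>
    { toAsyncAut := s.detectors.toAsyncAut.localCascade (AsyncAut.laterDetector s.detectors A)
      out := fun x r => (s.detectors.out x (fun j => (r j).1),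
        globalState A.init x.2 (fun j => (r j).2)) }

/-- The transducer on `G ∘^r (A_1^g ∘_ℓ ⋯ ∘_ℓ A_n^g)`: on an `a`-state `(υ_a, q_1, …, q_n)` its
output is `(globalstate_{(a,γ)}(q_1), …, globalstate_{(a,γ)}(q_n))`, where `γ` is the output of
`G` on `υ_a`. -/
noncomputable def GlobalCascadeSeq.transducer {P α : Type u} [Finite P] {D : DistAlphabet P α}
    {Λ : Type u} (s : GlobalCascadeSeq D Λ) (G : Transducer D (PrimaryLabel P)) :
    Transducer D Λ where
  toAsyncAut := G.restrictedCascade s.detectors.toAsyncAut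
  out a r := s.detectors.out (a, G.out a (fun j => (r j).1)) (fun j => (r j).2)

/-! The local state of process `i` changes only at events of `i`, so after a prefix it is the state
entered at the last event of `i` there. If `e_i ≤ e_j`, the global state reached on the events up to
`e_j` therefore has the correct `i`-component for the strict past of `e`. Let every process store
the state of `A` on its view. The label of `θ^Y` then tells the participants of `e` whose copy to
trust for each `i` (`globalState_primaryOrder`). If no participant qualifies, `i` has not acted,
since every event below `e` lies below an event of a participant. After `e`, all participants have
the same view, the events up to `e`. For a cascade, induction on the sequence gives each automaton
the trace relabelled by its predecessors (`detectors_labelling`); relabelling changes neither order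
nor locations.

The existence of a transducer for `θ^Y` is the gossip construction. Each process keeps tags, built
from boundedly many time stamps, of the last events and of the last events known to those. An event
takes a stamp unused in this table for its strict past. Events that are last in views of one prefix
are then identified by their tags (`eq_of_tag_eq`). Participants can thus compare their knowledge
(`sees_gossip_view`), merge it (`merge_gossip_view`) and update it (`update_gossip_Iio`). -/

section

/-! ### Views and last events in prefixes of a trace. -/

namespace Trace

variable {P α : Type u} {D : DistAlphabet P α}

/-- `f` is the last event of process `i` in `c`. -/
def IsLast (t : Trace D) (c : LowerSet t.E) (i : P) (f : t.E) : Prop :=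
  IsGreatest {g : t.E | g ∈ c ∧ i ∈ D.loc (t.label g)} f

theorem le_or_le_of_mem (t : Trace D) {i : P} {e f : t.E} (he : i ∈ D.loc (t.label e))
    (hf : i ∈ D.loc (t.label f)) : e ≤ f ∨ f ≤ e :=
  t.le_or_le_of_dep e f ⟨i, he, hf⟩

theorem exists_isLast (t : Trace D) {c : LowerSet t.E} {i : P} {e : t.E} (hc : e ∈ c)
    (hi : i ∈ D.loc (t.label e)) : ∃ f, t.IsLast c i f := by
  obtain ⟨f, hf⟩ := (Set.toFinite {g : t.E | g ∈ c ∧ i ∈ D.loc (t.label g)}).exists_maximal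
    ⟨e, hc, hi⟩
  refine ⟨f, hf.1, fun g hg => ?_⟩
  exact (t.le_or_le_of_mem hg.2 hf.1.2).elim id fun h => hf.2 hg h

/-- The part of `c` that process `i` is aware of: the events below some event of `i` in `c`. -/
def view (t : Trace D) (c : LowerSet t.E) (i : P) : LowerSet t.E where
  carrier := {e | ∃ f ∈ c, i ∈ D.loc (t.label f) ∧ e ≤ f}
  lower' := fun _ _ hba ⟨f, hf, hi, h⟩ => ⟨f, hf, hi, hba.trans h⟩

theorem view_le (t : Trace D) (c : LowerSet t.E) (i : P) : t.view c i ≤ c :=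
  fun _ ⟨_, hf, _, h⟩ => c.lower h hf

theorem mem_view_of_mem {t : Trace D} {c : LowerSet t.E} {i : P} {e : t.E} (hc : e ∈ c)
    (hi : i ∈ D.loc (t.label e)) : e ∈ t.view c i :=
  ⟨e, hc, hi, le_rfl⟩

theorem IsLast.view_eq {t : Trace D} {c : LowerSet t.E} {i : P} {f : t.E} (h : t.IsLast c i f) :
    t.view c i = LowerSet.Iic f := by
  ext e
  exact ⟨fun ⟨g, hg, hi, hle⟩ => hle.trans (h.2 ⟨hg, hi⟩), fun he => ⟨f, h.1.1, h.1.2, he⟩⟩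

theorem view_eq_bot {t : Trace D} {c : LowerSet t.E} {i : P}
    (h : ∀ e ∈ c, i ∉ D.loc (t.label e)) : t.view c i = ⊥ :=
  le_bot_iff.1 fun _ ⟨g, hg, hi, _⟩ => (h g hg hi).elim

theorem IsLast.of_le {t : Trace D} {c d : LowerSet t.E} {i : P} {f : t.E} (h : t.IsLast d i f)
    (hcd : c ≤ d) (hf : f ∈ c) : t.IsLast c i f :=
  ⟨⟨hf, h.1.2⟩, fun _ hg => h.2 ⟨hcd hg.1, hg.2⟩⟩

/-- Every event below `e` is known to some process that takes part in `e`. -/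
theorem exists_mem_view_Iio (t : Trace D) {e f : t.E} (h : f < e) :
    ∃ i ∈ D.loc (t.label e), f ∈ t.view (LowerSet.Iio e) i := by
  have : Fintype t.E := Fintype.ofFinite _
  classical
  have : LocallyFiniteOrder t.E := Fintype.toLocallyFiniteOrder
  -- An event covered by `e` depends on `e`, so it shares a process with `e`.
  obtain ⟨g, hfg, hge⟩ := exists_le_covBy_of_lt h
  obtain ⟨i, hig, hie⟩ := t.dep_of_covBy g e hge
  exact ⟨i, hie, g, hge.lt, hig, hfg⟩

/-- Any set of events can be listed in an order compatible with that of the trace. -/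
theorem exists_list (t : Trace D) (s : Set t.E) :
    ∃ l : List t.E, l.Pairwise (fun e f => ¬ f ≤ e) ∧ ∀ e, e ∈ l ↔ e ∈ s := by
  classical
  refine ⟨t.linearization.filter (· ∈ s), t.linearization_spec.1.filter _, fun e => ?_⟩
  simp [t.linearization_spec.2 e]

end Trace

/-! ### Runs of asynchronous automata on prefixes. -/

namespace AsyncAut

variable {P α : Type u} {D : DistAlphabet P α}

theorem Δ_of_mem (A : AsyncAut D) {a : α} {i : P} (h : i ∈ D.loc a) (s : A.Global) :
    A.Δ a s i = A.δ a (restrictState (D.loc a) s) ⟨i, h⟩ :=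
  dif_pos h

theorem Δ_of_notMem (A : AsyncAut D) {a : α} {i : P} (h : i ∉ D.loc a) (s : A.Global) :
    A.Δ a s i = s i :=
  dif_neg h

theorem runList_append (A : AsyncAut D) (t : Trace D) (l l' : List t.E) (s : A.Global) :
    A.runList t (l ++ l') s = A.runList t l' (A.runList t l s) :=
  List.foldl_append

theorem runList_cons (A : AsyncAut D) (t : Trace D) (e : t.E) (l : List t.E) (s : A.Global) :
    A.runList t (e :: l) s = A.runList t l (A.Δ (t.label e) s) := rfl

theorem runList_apply_of_forall_notMem (A : AsyncAut D) (t : Trace D) {i : P} (l : List t.E)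
    (h : ∀ e ∈ l, i ∉ D.loc (t.label e)) (s : A.Global) : A.runList t l s i = s i := by
  induction l generalizing s with
  | nil => rfl
  | cons e l ih =>
    rw [runList_cons, ih fun f hf => h f (List.mem_cons_of_mem _ hf),
      Δ_of_notMem A (h e List.mem_cons_self)]

theorem run_restrict_eq (A : AsyncAut D) (t : Trace D) (c : LowerSet t.E) (l : List t.E)
    (hl : l.Pairwise (fun e f => ¬ f ≤ e)) (hm : ∀ e, e ∈ l ↔ e ∈ c) :
    A.run (t.restrict c) = A.runList t l A.init := by
  lift l to List {e // e ∈ c} using fun e he => (hm e).1 he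
  rw [A.run_eq (t.restrict c) l ⟨(List.pairwise_map.1 hl).imp fun h => h, fun e => ?_⟩]
  · simp only [runList, List.foldl_map]
    rfl
  · obtain ⟨e', he', h⟩ := List.mem_map.1 ((hm e.1).2 e.2)
    exact Subtype.ext h ▸ he'

theorem run_of_forall_notMem (A : AsyncAut D) {t : Trace D} {c : LowerSet t.E} {i : P}
    (h : ∀ e ∈ c, i ∉ D.loc (t.label e)) : A.run (t.restrict c) i = A.init i := by
  obtain ⟨l, hl, hm⟩ := t.exists_list c
  rw [A.run_restrict_eq t c l hl hm]
  exact A.runList_apply_of_forall_notMem t l (fun e he => h e ((hm e).1 he)) _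

theorem run_bot (A : AsyncAut D) (t : Trace D) : A.run (t.restrict ⊥) = A.init :=
  funext fun _ => A.run_of_forall_notMem fun _ h => h.elim

/-- The state of process `i` is the one that it entered with its last event. -/
theorem run_of_isLast (A : AsyncAut D) {t : Trace D} {c : LowerSet t.E} {i : P} {f : t.E}
    (h : t.IsLast c i f) :
    A.run (t.restrict c) i = A.Δ (t.label f) (A.run (t.strictPast f)) i := by
  -- Linearize `c` as the strict past of `f`, then `f`, then the rest. Every event of `i` in `c` is
  -- below or equal to `f`, so the rest leaves the state of `i` alone.
  obtain ⟨l₁, hl₁, hm₁⟩ := t.exists_list {e | e < f}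
  obtain ⟨l₂, hl₂, hm₂⟩ := t.exists_list {e | e ∈ c ∧ ¬ e ≤ f}
  simp only [Set.mem_ofPred_eq] at hm₁ hm₂
  have hl : (l₁ ++ f :: l₂).Pairwise (fun e f => ¬ f ≤ e) := by
    refine List.pairwise_append.2 ⟨hl₁, List.pairwise_cons.2
      ⟨fun e he => ((hm₂ e).1 he).2, hl₂⟩, fun a ha b hb hba => ?_⟩
    have ha := (hm₁ a).1 ha
    rcases List.mem_cons.1 hb with rfl | hb
    · exact ha.not_ge hba
    · exact ((hm₂ b).1 hb).2 (hba.trans ha.le)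
  have hm : ∀ e, e ∈ l₁ ++ f :: l₂ ↔ e ∈ c := by
    intro e
    rw [List.mem_append, List.mem_cons, hm₁, hm₂]
    refine ⟨?_, fun he => ?_⟩
    · rintro (he | rfl | he)
      · exact c.lower he.le h.1.1
      · exact h.1.1
      · exact he.1
    · by_cases hef : e ≤ f
      · exact hef.lt_or_eq.elim Or.inl fun h => Or.inr (Or.inl h)
      · exact Or.inr (Or.inr ⟨he, hef⟩)
  rw [A.run_restrict_eq t c _ hl hm, Trace.strictPast,
    A.run_restrict_eq t (LowerSet.Iio f) l₁ hl₁ hm₁, runList_append, runList_cons]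
  refine A.runList_apply_of_forall_notMem t l₂ (fun e he hi => ?_) _
  exact ((hm₂ e).1 he).2 (h.2 ⟨((hm₂ e).1 he).1, hi⟩)

theorem run_Iic (A : AsyncAut D) (t : Trace D) (f : t.E) :
    A.run (t.restrict (LowerSet.Iic f)) = A.Δ (t.label f) (A.run (t.strictPast f)) := by
  funext i
  by_cases hi : i ∈ D.loc (t.label f)
  · exact A.run_of_isLast ⟨⟨le_rfl, hi⟩, fun g hg => hg.1⟩
  · rw [Δ_of_notMem A hi, Trace.strictPast]
    -- A process outside `f` has the same last event in `Iic f` and in `Iio f`.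
    have key : ∀ {g}, g ∈ LowerSet.Iic f → i ∈ D.loc (t.label g) → g ∈ LowerSet.Iio f :=
      fun {g} hg hgi => LowerSet.mem_Iio_iff.2
        ((LowerSet.mem_Iic_iff.1 hg).lt_of_ne fun h => hi (h ▸ hgi))
    by_cases h : ∃ g ∈ LowerSet.Iic f, i ∈ D.loc (t.label g)
    · obtain ⟨g, hg, hgi⟩ := h
      obtain ⟨x, hx⟩ := t.exists_isLast hg hgi
      rw [A.run_of_isLast hx,
        A.run_of_isLast (hx.of_le (c := LowerSet.Iio f) (fun y hy => le_of_lt hy)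
          (key hx.1.1 hx.1.2))]
    · push Not at h
      rw [A.run_of_forall_notMem h,
        A.run_of_forall_notMem fun e he => h e (le_of_lt he)]

/-- An assignment of global states to the prefixes of a trace that satisfies the recursion for
the local states is the run of the automaton. -/
theorem run_eq_of_recursion (A : AsyncAut D) (t : Trace D) (st : LowerSet t.E → A.Global)
    (h₀ : ∀ c i, (∀ e ∈ c, i ∉ D.loc (t.label e)) → st c i = A.init i)
    (h₁ : ∀ c i f, ∀ h : t.IsLast c i f, st c i =
      A.δ (t.label f) (restrictState (D.loc (t.label f)) (st (LowerSet.Iio f))) ⟨i, h.1.2⟩)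
    (c : LowerSet t.E) : A.run (t.restrict c) = st c := by
  have : Finite (LowerSet t.E) := Finite.of_injective _ SetLike.coe_injective
  induction c using WellFoundedLT.induction with
  | ind c ih =>
    funext i
    by_cases h : ∃ e ∈ c, i ∈ D.loc (t.label e)
    · obtain ⟨e, he, hi⟩ := h
      obtain ⟨f, hf⟩ := t.exists_isLast he hi
      rw [h₁ c i f hf, A.run_of_isLast hf, Δ_of_mem A hf.1.2, Trace.strictPast, ih]
      -- The prefix `Iio f` is strictly smaller than `c` because it misses `f`.
      refine lt_of_le_of_ne (fun g hg => c.lower (le_of_lt hg) hf.1.1) fun heq => ?_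
      exact lt_irrefl f (LowerSet.mem_Iio_iff.1 (heq ▸ hf.1.1))
    · push Not at h
      rw [h₀ c i h, A.run_of_forall_notMem h]

end AsyncAut

end

/-! ### Correctness of the global-state detectors. -/

section

variable {P α : Type u} {D : DistAlphabet P α}

theorem Transducer.Computes.labelling_eq {Γ : Type u} {T : Transducer D Γ} {θ : Labelling D Γ}
    (h : T.Computes θ) : T.labelling = θ := by
  funext t e
  -- Equal traces have only heterogeneously equal labels, but both event types are `t.E` by
  -- definition.
  have h₁ : (T.labelling.apply t).label ≍ (θ.apply t).label := by rw [h t]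
  exact congrArg Prod.snd (congrFun (eq_of_heq h₁) e)

theorem Transducer.computes_of_labelling_eq {Γ : Type u} {T : Transducer D Γ}
    {θ : Labelling D Γ} (h : T.labelling = θ) : T.Computes θ :=
  fun _ => h ▸ rfl

theorem primaryOrder_eq_true {t : Trace D} {e : t.E} {i j : P} :
    primaryOrder D t e (i, j) = true ↔
      ∃ f g, t.IsLast (LowerSet.Iio e) i f ∧ t.IsLast (LowerSet.Iio e) j g ∧ f ≤ g := by
  classical
  exact decide_eq_true_iff

/-- The states that the participants of `e` reach on their views combine to the global state
on the strict past of `e`. -/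
theorem globalState_primaryOrder (A : AsyncAut D) (t : Trace D) (e : t.E) :
    globalState A.init (primaryOrder D t e) (fun j : D.loc (t.label e) =>
      A.run (t.restrict (t.view (LowerSet.Iio e) j))) = A.run (t.strictPast e) := by
  funext i
  unfold globalState Trace.strictPast
  split_ifs with h
  -- The view of the chosen process is `Iic g`. It contains `f`, so `f` is the last event of `i`
  -- there too, and `i` has entered the same state.
  · obtain ⟨f, g, hf, hg, hfg⟩ := primaryOrder_eq_true.1 h.choose_spec
    beta_reduce
    rw [hg.view_eq, A.run_of_isLast hf, A.run_of_isLast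
      (hf.of_le (fun x hx => (LowerSet.mem_Iic_iff.1 hx).trans_lt hg.1.1) hfg)]
  -- A last event of `i` would lie below the last event of some participant, which would make an
  -- entry of the label true.
  · refine (A.run_of_forall_notMem fun f hf hi => h ?_).symm
    obtain ⟨f, hf⟩ := t.exists_isLast hf hi
    obtain ⟨j, hj, g, hg, hjg, hfg⟩ := t.exists_mem_view_Iio hf.1.1
    obtain ⟨g', hg'⟩ := t.exists_isLast (c := LowerSet.Iio e) hg hjg
    exact ⟨⟨j, hj⟩, primaryOrder_eq_true.2 ⟨f, g', hf, hg', hfg.trans (hg'.2 ⟨hg, hjg⟩)⟩⟩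

/-- The trace relabelled by `G` has the same prefixes and last events, so the two runs side by side
satisfy the recursion of the product. -/
theorem Transducer.restrictedCascade_run {Γ : Type u} (G : Transducer D Γ)
    (B : AsyncAut (D.prod Γ)) (t : Trace D) (c : LowerSet t.E) :
    (G.restrictedCascade B).run (t.restrict c) = fun i =>
      (G.run (t.restrict c) i, B.run ((G.labelling.apply t).restrict c) i) := by
  refine AsyncAut.run_eq_of_recursion (G.restrictedCascade B) t (fun c i =>
    (G.run (t.restrict c) i, B.run ((G.labelling.apply t).restrict c) i)) ?_ ?_ c
  · intro c i h
    exact Prod.ext (G.run_of_forall_notMem h)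
      (B.run_of_forall_notMem (t := G.labelling.apply t) h)
  · intro c i f h
    refine Prod.ext ?_ ?_
    · exact (G.run_of_isLast h).trans (G.Δ_of_mem h.1.2 _)
    · exact (B.run_of_isLast (t := G.labelling.apply t) h).trans
        (B.Δ_of_mem (a := (G.labelling.apply t).label f) h.1.2 _)

theorem AsyncAut.localCascade_run_fst (A : AsyncAut D) (B : AsyncAut (D.lprod A.S))
    (t : Trace D) (c : LowerSet t.E) (i : P) :
    ((A.localCascade B).run (t.restrict c) i).1 = A.run (t.restrict c) i := by
  refine (congrFun (A.run_eq_of_recursion t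
    (fun c i => ((A.localCascade B).run (t.restrict c) i).1) ?_ ?_ c) i).symm
  · intro c i h
    exact congrArg Prod.fst ((A.localCascade B).run_of_forall_notMem h)
  · intro c i f h
    exact congrArg Prod.fst (((A.localCascade B).run_of_isLast h).trans
      ((A.localCascade B).Δ_of_mem h.1.2 _))

theorem AsyncAut.run_view_of_forall_notMem (A : AsyncAut D) {t : Trace D} {c : LowerSet t.E}
    {i : P} (h : ∀ e ∈ c, i ∉ D.loc (t.label e)) :
    A.run (t.restrict (t.view c i)) = A.init := by
  rw [Trace.view_eq_bot h, A.run_bot]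

/-- After its last event `f`, process `i` knows the global state reached from the combined
states of the participants of `f`. -/
theorem AsyncAut.run_view_of_isLast (A : AsyncAut D) {t : Trace D} {c : LowerSet t.E}
    {i : P} {f : t.E} (h : t.IsLast c i f) :
    A.run (t.restrict (t.view c i)) = A.Δ (t.label f)
      (globalState A.init (primaryOrder D t f) (fun j : D.loc (t.label f) =>
        A.run (t.restrict (t.view (LowerSet.Iio f) j)))) := by
  rw [h.view_eq, A.run_Iic, globalState_primaryOrder]

variable [Finite P]

/-- This is the invariant of the detector: each process stores the state of `A` on its own view. -/
theorem AsyncAut.detector_run (A : AsyncAut D) (t : Trace D) (c : LowerSet t.E) :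
    A.detector.run (((primaryOrder D).apply t).restrict c) =
      fun i => A.run (t.restrict (t.view c i)) := by
  refine A.detector.run_eq_of_recursion ((primaryOrder D).apply t)
    (fun c i => A.run (t.restrict (t.view c i))) ?_ ?_ c
  · intro c i h
    exact A.run_view_of_forall_notMem h
  · intro c i f h
    exact A.run_view_of_isLast h

theorem AsyncAut.localCascade_laterDetector_run_snd {Λ : Type u}
    (B : Transducer (D.prod (PrimaryLabel P)) Λ) (A : AsyncAut (D.prod Λ)) (t : Trace D)
    (c : LowerSet t.E) (i : P) (θ : Labelling D Λ)
    (hθ : ∀ e, B.labelling ((primaryOrder D).apply t) e = θ t e) :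
    ((B.localCascade (AsyncAut.laterDetector B A)).run
      (((primaryOrder D).apply t).restrict c) i).2 =
      A.run ((θ.apply t).restrict ((θ.apply t).view c i)) := by
  set t' := (primaryOrder D).apply t with ht'
  set C := B.localCascade (AsyncAut.laterDetector B A) with hC
  -- The state of `B` is carried along because the letter fed to `A` depends on the output of `B`.
  have key := C.run_eq_of_recursion t' (fun c i => (B.run (t'.restrict c) i,
    A.run ((θ.apply t).restrict ((θ.apply t).view c i)))) ?_ ?_ c
  · exact congrArg Prod.snd (congrFun key i)
  · intro c i h
    exact Prod.ext (B.run_of_forall_notMem h)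
      (A.run_view_of_forall_notMem (t := θ.apply t) h)
  · intro c i f h
    refine Prod.ext ?_ ?_
    · exact (B.run_of_isLast h).trans (B.Δ_of_mem h.1.2 _)
    · refine (A.run_view_of_isLast (t := θ.apply t) h).trans ?_
      have h₁ : (θ.apply t).label f = (t.label f, B.labelling t' f) :=
        Prod.ext rfl (hθ f).symm
      change A.Δ ((θ.apply t).label f) _ = A.Δ (t.label f, B.labelling t' f) _
      rw [← h₁]
      rfl

/-- By induction, the earlier detectors output exactly the labels that the next automaton reads, so
its detector works as for a single automaton over the relabelled trace. -/
theorem GlobalCascadeSeq.detectors_labelling {Λ : Type u} (s : GlobalCascadeSeq D Λ)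
    (t : Trace D) (e : t.E) :
    s.detectors.labelling ((primaryOrder D).apply t) e = s.globalLabelling t e := by
  induction s generalizing e with
  | single A =>
    refine Eq.trans ?_ (globalState_primaryOrder A t e)
    refine congrArg (globalState (Q := D.loc (t.label e)) A.init (primaryOrder D t e)) ?_
    funext j
    exact congrFun (A.detector_run t (LowerSet.Iio e)) j
  | snoc s A ih =>
    refine Prod.ext ?_ ?_
    · refine Eq.trans ?_ (ih e)
      refine congrArg (s.detectors.out _) ?_
      funext j
      exact AsyncAut.localCascade_run_fst _ _ _ _ _
    · refine Eq.trans ?_ (globalState_primaryOrder A (s.globalLabelling.apply t) e)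
      change globalState (Q := D.loc (t.label e)) A.init (primaryOrder D t e) (fun j =>
        ((s.detectors.localCascade (AsyncAut.laterDetector s.detectors A)).run
          (((primaryOrder D).apply t).restrict (LowerSet.Iio e)) j).2) = _
      -- The primary order depends only on order and locations.
      have h : primaryOrder D t e = primaryOrder (D.prod _) (s.globalLabelling.apply t) e := rfl
      rw [← h]
      refine congrArg (globalState (Q := D.loc (t.label e)) A.init (primaryOrder D t e)) ?_
      funext j
      exact AsyncAut.localCascade_laterDetector_run_snd s.detectors A t (LowerSet.Iio e) j
        s.globalLabelling ih

theorem GlobalCascadeSeq.transducer_computes {Λ : Type u} (s : GlobalCascadeSeq D Λ)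
    (G : Transducer D (PrimaryLabel P)) (hG : G.Computes (primaryOrder D)) :
    (s.transducer G).Computes s.globalLabelling := by
  refine Transducer.computes_of_labelling_eq ?_
  funext t e
  rw [← s.detectors_labelling t e, ← hG.labelling_eq]
  have h := G.restrictedCascade_run s.detectors.toAsyncAut t (LowerSet.Iio e)
  have h₁ : G.labelling t e = G.out (t.label e)
    (restrictState (D.loc (t.label e)) (G.run (t.strictPast e))) := rfl
  change s.detectors.out (t.label e, G.out (t.label e) (fun j =>
    ((G.restrictedCascade s.detectors.toAsyncAut).run
      (t.restrict (LowerSet.Iio e)) j.1).1)) (fun j =>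
    ((G.restrictedCascade s.detectors.toAsyncAut).run
      (t.restrict (LowerSet.Iio e)) j.1).2) = _
  rw [h]
  rfl

end

/-! ### Bounded time stamps and tags. -/

section

variable {P α : Type u} {D : DistAlphabet P α}

/-- Time stamps: there is one more than there are pairs of processes. -/
abbrev Stamp (P : Type u) : Type u := Option (P × P)

/-- Pigeonhole: if every stamp occurred, `Option (P × P)` would inject into `P × P`. -/
theorem exists_fresh_stamp [Finite P] (g : P × P → Option (Stamp P)) :
    ∃ s : Stamp P, ∀ p, g p ≠ some s := by
  by_contra! h
  choose f hf using h
  have hinj : Function.Injective f := fun s s' hs =>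
    Option.some_injective _ ((hf s).symm.trans ((congrArg g hs).trans (hf s')))
  have : Fintype P := Fintype.ofFinite P
  have := Fintype.card_le_of_injective f hinj
  simp at this

/-- A stamp that differs from all stamps in the given family. -/
noncomputable def freshStamp [Finite P] (g : P × P → Option (Stamp P)) : Stamp P :=
  (exists_fresh_stamp g).choose

theorem freshStamp_spec [Finite P] (g : P × P → Option (Stamp P)) (p : P × P) :
    g p ≠ some (freshStamp g) :=
  (exists_fresh_stamp g).choose_spec p

namespace Trace

open Classical in
/-- The last event of process `i` in `c`, if there is one. -/
noncomputable def last (t : Trace D) (c : LowerSet t.E) (i : P) : Option t.E :=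
  if h : ∃ f, t.IsLast c i f then some h.choose else none

theorem IsLast.unique {t : Trace D} {c : LowerSet t.E} {i : P} {f g : t.E}
    (hf : t.IsLast c i f) (hg : t.IsLast c i g) : f = g :=
  IsGreatest.unique hf hg

theorem last_eq_some {t : Trace D} {c : LowerSet t.E} {i : P} {f : t.E} :
    t.last c i = some f ↔ t.IsLast c i f := by
  unfold last
  split_ifs with h
  · rw [Option.some_inj]
    exact ⟨fun hf => hf ▸ h.choose_spec, fun hf => h.choose_spec.unique hf⟩
  · exact ⟨fun hf => by simp at hf, fun hf => (h ⟨f, hf⟩).elim⟩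

theorem last_eq_none {t : Trace D} {c : LowerSet t.E} {i : P} :
    t.last c i = none ↔ ∀ f ∈ c, i ∉ D.loc (t.label f) := by
  refine ⟨fun h f hf hi => ?_, fun h => ?_⟩
  · obtain ⟨g, hg⟩ := t.exists_isLast hf hi
    rw [last_eq_some.2 hg] at h
    simp at h
  · refine Option.eq_none_iff_forall_ne_some.2 fun f hf => ?_
    have := last_eq_some.1 hf
    exact h f this.1.1 this.1.2

/-- The last event of process `m` that is known to the last event of process `k` in `c`. -/
noncomputable def last₂ (t : Trace D) (c : LowerSet t.E) (p : P × P) : Option t.E :=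
  (t.last c p.1).bind fun y => t.last (LowerSet.Iic y) p.2

theorem last₂_eq_some {t : Trace D} {c : LowerSet t.E} {p : P × P} {f : t.E} :
    t.last₂ c p = some f ↔
      ∃ y, t.IsLast c p.1 y ∧ t.IsLast (LowerSet.Iic y) p.2 f := by
  simp [last₂, Option.bind_eq_some_iff, last_eq_some]

theorem IsLast.of_Iic {t : Trace D} {c : LowerSet t.E} {i : P} {f : t.E}
    (h : t.IsLast c i f) : t.IsLast (LowerSet.Iic f) i f :=
  ⟨⟨le_rfl, h.1.2⟩, fun _ hg => hg.1⟩

/-- The diagonal of the table thus holds the last events themselves. -/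
theorem last₂_self (t : Trace D) (c : LowerSet t.E) (i : P) :
    t.last₂ c (i, i) = t.last c i := by
  ext f
  rw [last₂_eq_some, last_eq_some]
  refine ⟨fun ⟨y, hy, hf⟩ => ?_, fun h => ⟨f, h, h.of_Iic⟩⟩
  rwa [hf.unique hy.of_Iic]

theorem mem_of_last₂ {t : Trace D} {c : LowerSet t.E} {p : P × P} {f : t.E}
    (h : t.last₂ c p = some f) : f ∈ c := by
  obtain ⟨y, hy, hf⟩ := last₂_eq_some.1 h
  exact c.lower hf.1.1 hy.1.1

section Stamps

variable [Finite P]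

open Classical in
/-- The time stamp of the event `e` differs from the stamps of all events that are the last
known to the last event of some process in the strict past of `e`. -/
noncomputable def stamp (t : Trace D) : t.E → Stamp P :=
  IsWellFounded.fix (· < ·) fun e rec => freshStamp fun p =>
    (t.last₂ (LowerSet.Iio e) p).bind fun f => if h : f < e then some (rec f h) else none

theorem stamp_eq (t : Trace D) (e : t.E) :
    t.stamp e = freshStamp fun p => (t.last₂ (LowerSet.Iio e) p).map t.stamp := by
  rw [stamp, IsWellFounded.fix_eq]
  refine congrArg freshStamp (funext fun p => ?_)
  rcases h : t.last₂ (LowerSet.Iio e) p with _ | f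
  · rfl
  -- The guard `f < e` in `stamp` is there for termination only; it always holds.
  · exact dif_pos (LowerSet.mem_Iio_iff.1 (mem_of_last₂ h))

theorem stamp_ne (t : Trace D) {e f : t.E} {p : P × P}
    (h : t.last₂ (LowerSet.Iio e) p = some f) : t.stamp f ≠ t.stamp e := by
  intro hs
  rw [t.stamp_eq e] at hs
  refine freshStamp_spec (fun p => (t.last₂ (LowerSet.Iio e) p).map t.stamp) p ?_
  rw [← hs, h]
  rfl

/-- The letter and the time stamp of an event. -/
noncomputable def tag (t : Trace D) (e : t.E) : α × Stamp P := (t.label e, t.stamp e)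

end Stamps

/-- An event that is maximal in the intersection of a view in `c` with a prefix `w` of `c` is the
last event of some process in `w`. -/
theorem exists_isLast_of_maximal {t : Trace D} {c w : LowerSet t.E} {j : P} {z : t.E}
    (hw : w ≤ c) (hz : Maximal (fun x => x ∈ t.view c j ∧ x ∈ w) z) :
    ∃ p, t.IsLast w p z := by
  -- If `z` is not maximal in the view, it shares a process `p` with some cover `z'` in the view. By
  -- maximality `z'` is outside `w`, so events of `p` in `w` cannot pass `z`. Otherwise `z` is the
  -- last event of `j` in `c`.
  by_cases h : ∃ y ∈ t.view c j, z < y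
  · obtain ⟨y, hy, hzy⟩ := h
    have : Fintype t.E := Fintype.ofFinite _
    classical
    have : LocallyFiniteOrder t.E := Fintype.toLocallyFiniteOrder
    obtain ⟨z', hzz', hz'⟩ := exists_covBy_le_of_lt hzy
    obtain ⟨p, hp, hp'⟩ := t.dep_of_covBy z z' hzz'
    have hz'u : z' ∈ t.view c j := (t.view c j).lower hz' hy
    refine ⟨p, ⟨hz.1.2, hp⟩, fun x ⟨hx, hxp⟩ => ?_⟩
    rcases t.le_or_le_of_mem hxp hp' with h | h
    · rcases t.le_or_le_of_mem hxp hp with h' | h'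
      · exact h'
      · exact hz.2 ⟨(t.view c j).lower h hz'u, hx⟩ h'
    · exact (hzz'.lt.not_ge (hz.2 ⟨hz'u, w.lower h hx⟩ hzz'.le)).elim
  · push Not at h
    obtain ⟨f, hf, hj, hzf⟩ := hz.1.1
    obtain rfl : z = f := hzf.eq_of_not_lt (h f (mem_view_of_mem hf hj))
    refine ⟨j, ⟨hz.1.2, hj⟩, fun x ⟨hx, hxj⟩ => ?_⟩
    rcases t.le_or_le_of_mem hxj hj with h' | h'
    · exact h'
    · exact (h'.eq_of_not_lt (h x (mem_view_of_mem (hw hx) hxj))).ge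

theorem exists_maximal_ge {t : Trace D} {u w : LowerSet t.E} {x : t.E} (hu : x ∈ u)
    (hw : x ∈ w) : ∃ z, x ≤ z ∧ Maximal (fun x => x ∈ u ∧ x ∈ w) z :=
  (Set.toFinite {x | x ∈ u ∧ x ∈ w}).exists_le_maximal ⟨hu, hw⟩

theorem last_Iic_of_mem {t : Trace D} {e : t.E} {k : P} (h : k ∈ D.loc (t.label e)) :
    t.last (LowerSet.Iic e) k = some e :=
  last_eq_some.2 ⟨⟨le_rfl, h⟩, fun _ hg => hg.1⟩

theorem isLast_Iic_of_notMem {t : Trace D} {e : t.E} {k : P} (h : k ∉ D.loc (t.label e))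
    {x : t.E} : t.IsLast (LowerSet.Iic e) k x ↔ t.IsLast (LowerSet.Iio e) k x := by
  have : {g : t.E | g ∈ LowerSet.Iic e ∧ k ∈ D.loc (t.label g)} =
      {g : t.E | g ∈ LowerSet.Iio e ∧ k ∈ D.loc (t.label g)} := by
    ext g
    exact ⟨fun ⟨hg, hk⟩ => ⟨(LowerSet.mem_Iic_iff.1 hg).lt_of_ne fun h' => h (h' ▸ hk), hk⟩,
      fun ⟨hg, hk⟩ => ⟨le_of_lt hg, hk⟩⟩
  rw [IsLast, IsLast, this]

theorem last_Iic_of_notMem {t : Trace D} {e : t.E} {k : P} (h : k ∉ D.loc (t.label e)) :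
    t.last (LowerSet.Iic e) k = t.last (LowerSet.Iio e) k := by
  ext x
  rw [last_eq_some, last_eq_some, isLast_Iic_of_notMem h]

theorem isLast_Iic_of_mem {t : Trace D} {e : t.E} {k : P} (h : k ∈ D.loc (t.label e))
    {x : t.E} : t.IsLast (LowerSet.Iic e) k x ↔ x = e := by
  rw [← last_eq_some, last_Iic_of_mem h, Option.some_inj, eq_comm]

section Tags

variable [Finite P]

/-- A maximal event `z` above `f` common to the view and `Iio e` is the last event of some process
`p` in `Iio e`. Since `f` is the last event of `q` known to `z`, the stamp of `e` was chosen to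
avoid that of `f`. -/
theorem tag_ne_of_lt {t : Trace D} {c : LowerSet t.E} {j q : P} {e f : t.E} (he : e ∈ c)
    (hf : t.IsLast (t.view c j) q f) (hfe : f < e) : t.tag f ≠ t.tag e := by
  intro h
  obtain ⟨z, hfz, hz⟩ := exists_maximal_ge (w := LowerSet.Iio e) hf.1.1 hfe
  obtain ⟨p, hp⟩ := exists_isLast_of_maximal
    (fun x hx => c.lower (LowerSet.mem_Iio_iff.1 hx).le he) hz
  refine t.stamp_ne (p := (p, q)) (last₂_eq_some.2 ⟨z, hp, ?_⟩) (congrArg Prod.snd h)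
  exact hf.of_le (fun x hx => (t.view c j).lower hx hz.1.1) hfz

/-- The tags identify the events that are last events in views of the same prefix. -/
theorem eq_of_tag_eq {t : Trace D} {c : LowerSet t.E} {i j p q : P} {e f : t.E}
    (he : t.IsLast (t.view c i) p e) (hf : t.IsLast (t.view c j) q f)
    (h : t.tag e = t.tag f) : e = f := by
  have hl : t.label e = t.label f := congrArg Prod.fst h
  by_contra hne
  -- Equal letters share a process, so the events are comparable. This is why the tag includes the
  -- letter.
  rcases t.le_or_le_of_mem he.1.2 (hl ▸ he.1.2) with hef | hfe
  · exact tag_ne_of_lt (t.view_le c j hf.1.1) he (lt_of_le_of_ne hef hne) h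
  · exact tag_ne_of_lt (t.view_le c i he.1.1) hf (lt_of_le_of_ne hfe (Ne.symm hne)) h.symm

end Tags

end Trace

/-! ### Comparing, merging and updating gossip. -/

/-- The information on a prefix that a process keeps: the tags of the last events of process `m`
known to the last event of process `k`, and the order of the last events of the processes. -/
structure Gossip (P α : Type u) : Type u where
  tag : P × P → Option (α × Stamp P)
  ord : P × P → Bool

instance [Finite P] [Finite α] : Finite (Gossip P α) :=
  Finite.of_injective (fun g : Gossip P α => (g.tag, g.ord)) fun ⟨_, _⟩ ⟨_, _⟩ h => by
    simpa using h

namespace Gossip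

/-- According to `x` and `y`, the last event of process `k` known to the owner of `x` is known to
the owner of `y`. -/
def Sees (x y : Gossip P α) (k : P) : Prop :=
  ∃ p q, x.ord (k, p) = true ∧ x.tag (p, p) = y.tag (q, q)

/-- Process `i` has the most recent information on process `k`. -/
def Best {Q : Set P} (x : Q → Gossip P α) (k : P) (i : Q) : Prop :=
  ∀ j, (x j).ord (k, k) = true → (x j).Sees (x i) k

open Classical in
/-- The information that the processes in `Q` have together. -/
noncomputable def merge {Q : Set P} (x : Q → Gossip P α) : Gossip P α where
  tag p := if h : ∃ i, Best x p.1 i then (x h.choose).tag p else none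
  ord p := decide (∃ i, Best x p.1 i ∧ Best x p.2 i ∧ (x i).ord p = true)

open Classical in
/-- The information after an event with letter `a`, from that before the event. -/
noncomputable def update [Finite P] (D : DistAlphabet P α) (a : α) (x : Gossip P α) :
    Gossip P α where
  tag p := if p.1 ∈ D.loc a then
      if p.2 ∈ D.loc a then some (a, freshStamp fun r => (x.tag r).map Prod.snd)
      else x.tag (p.2, p.2)
    else x.tag p
  ord p := if p.2 ∈ D.loc a then decide (p.1 ∈ D.loc a ∨ x.ord (p.1, p.1) = true)
    else decide (p.1 ∉ D.loc a ∧ x.ord p = true)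

end Gossip

namespace Trace

variable [Finite P]

open Classical in
/-- The information on the prefix `c`. -/
noncomputable def gossip (t : Trace D) (c : LowerSet t.E) : Gossip P α where
  tag p := (t.last₂ c p).map t.tag
  ord p := decide (∃ x y, t.IsLast c p.1 x ∧ t.IsLast c p.2 y ∧ x ≤ y)

theorem gossip_ord {t : Trace D} {c : LowerSet t.E} {k l : P} :
    (t.gossip c).ord (k, l) = true ↔ ∃ x y, t.IsLast c k x ∧ t.IsLast c l y ∧ x ≤ y := by
  classical
  exact decide_eq_true_iff

theorem gossip_ord_self {t : Trace D} {c : LowerSet t.E} {k : P} :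
    (t.gossip c).ord (k, k) = true ↔ ∃ x, t.IsLast c k x :=
  gossip_ord.trans ⟨fun ⟨x, _, hx, _⟩ => ⟨x, hx⟩, fun ⟨x, hx⟩ => ⟨x, x, hx, hx, le_rfl⟩⟩

theorem gossip_tag_self (t : Trace D) (c : LowerSet t.E) (k : P) :
    (t.gossip c).tag (k, k) = (t.last c k).map t.tag :=
  congrArg (Option.map t.tag) (t.last₂_self c k)

/-- If `x` lies in both views, a maximal common event above it is a last event of some process in
each of them, so its tag appears in both tables. Conversely, equal tags name the same event, and
views are downward closed. -/
theorem sees_gossip_view {t : Trace D} {c : LowerSet t.E} {i j k : P} {x : t.E}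
    (hx : t.IsLast (t.view c i) k x) :
    (t.gossip (t.view c i)).Sees (t.gossip (t.view c j)) k ↔ x ∈ t.view c j := by
  constructor
  · rintro ⟨p, q, ho, ht⟩
    obtain ⟨x', z, hx', hz, hle⟩ := gossip_ord.1 ho
    obtain rfl := hx.unique hx'
    rw [gossip_tag_self, gossip_tag_self, last_eq_some.2 hz, Option.map_some] at ht
    obtain ⟨z', hz', ht⟩ := Option.map_eq_some_iff.1 ht.symm
    have hz' := last_eq_some.1 hz'
    rw [← eq_of_tag_eq hz' hz ht] at hle
    exact (t.view c j).lower hle hz'.1.1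
  · intro hxj
    obtain ⟨z, hxz, hz⟩ := exists_maximal_ge hx.1.1 hxj
    obtain ⟨q, hq⟩ := exists_isLast_of_maximal (t.view_le c j) hz
    obtain ⟨p, hp⟩ := exists_isLast_of_maximal (w := t.view c i) (j := j) (t.view_le c i)
      (by simpa only [and_comm] using hz)
    refine ⟨p, q, gossip_ord.2 ⟨x, z, hx, hp, hxz⟩, ?_⟩
    rw [gossip_tag_self, gossip_tag_self, last_eq_some.2 hp, last_eq_some.2 hq]

section Merge

variable {t : Trace D} {c : LowerSet t.E} {Q : Set P}

theorem best_iff (hc : ∀ f ∈ c, ∃ i ∈ Q, f ∈ t.view c i) (k : P) (i : Q) :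
    Gossip.Best (fun j : Q => t.gossip (t.view c j)) k i ↔
      t.last (t.view c i) k = t.last c k := by
  constructor
  · intro h
    rcases hk : t.last c k with _ | x
    · exact last_eq_none.2 fun f hf => last_eq_none.1 hk f (t.view_le c i hf)
    · have hx := last_eq_some.1 hk
      obtain ⟨j, hj, hxj⟩ := hc x hx.1.1
      have hx' := hx.of_le (t.view_le c j) hxj
      exact last_eq_some.2 (hx.of_le (t.view_le c i)
        ((sees_gossip_view hx').1 (h ⟨j, hj⟩ (gossip_ord_self.2 ⟨x, hx'⟩))))
  · intro h j hj
    obtain ⟨y, hy⟩ := gossip_ord_self.1 hj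
    refine (sees_gossip_view hy).2 ?_
    obtain ⟨x, hx⟩ := t.exists_isLast (t.view_le c j hy.1.1) hy.1.2
    have hx' := last_eq_some.1 (h.trans (last_eq_some.2 hx))
    exact (t.view c i).lower (hx.2 ⟨t.view_le c j hy.1.1, hy.1.2⟩) hx'.1.1

/-- The last event of `k` lies in the view of some process in `Q`. If `k` has no event, any process
is best, whence the need for `Q` to be nonempty. -/
theorem exists_best (hc : ∀ f ∈ c, ∃ i ∈ Q, f ∈ t.view c i) (hQ : Q.Nonempty) (k : P) :
    ∃ i, Gossip.Best (fun j : Q => t.gossip (t.view c j)) k i := by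
  rcases hk : t.last c k with _ | x
  · obtain ⟨i, hi⟩ := hQ
    refine ⟨⟨i, hi⟩, (best_iff hc k _).2 (Eq.trans ?_ hk.symm)⟩
    exact last_eq_none.2 fun f hf => last_eq_none.1 hk f (t.view_le c i hf)
  · have hx := last_eq_some.1 hk
    obtain ⟨j, hj, hxj⟩ := hc x hx.1.1
    exact ⟨⟨j, hj⟩, (best_iff hc k _).2
      ((last_eq_some.2 (hx.of_le (t.view_le c j) hxj)).trans hk.symm)⟩

/-- The views of the processes in `Q` determine the information on their union. -/
theorem merge_gossip_view (hc : ∀ f ∈ c, ∃ i ∈ Q, f ∈ t.view c i) (hQ : Q.Nonempty) :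
    Gossip.merge (fun j : Q => t.gossip (t.view c j)) = t.gossip c := by
  unfold Gossip.merge
  rw [gossip, Gossip.mk.injEq]
  constructor
  · funext ⟨k, m⟩
    have h := exists_best hc hQ k
    refine (dif_pos h).trans ?_
    have hb := (best_iff hc k _).1 h.choose_spec
    change ((t.last (t.view c h.choose) k).bind _).map _ = ((t.last c k).bind _).map _
    rw [hb]
  · funext ⟨k, l⟩
    refine decide_eq_decide.2 ⟨?_, ?_⟩
    · rintro ⟨i, hk, hl, ho⟩
      obtain ⟨x, y, hx, hy, hxy⟩ := gossip_ord.1 ho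
      exact ⟨x, y, last_eq_some.1 (((best_iff hc k i).1 hk).symm.trans (last_eq_some.2 hx)),
        last_eq_some.1 (((best_iff hc l i).1 hl).symm.trans (last_eq_some.2 hy)), hxy⟩
    · rintro ⟨x, y, hx, hy, hxy⟩
      -- A process that is best for `l` has `y` in its view, hence also `x` below it, so it is best
      -- for `k` as well.
      obtain ⟨i, hi⟩ := exists_best hc hQ l
      have hy' := last_eq_some.1 (((best_iff hc l i).1 hi).trans (last_eq_some.2 hy))
      have hx' := hx.of_le (t.view_le c i) ((t.view c i).lower hxy hy'.1.1)
      exact ⟨i, (best_iff hc k i).2 ((last_eq_some.2 hx').trans (last_eq_some.2 hx).symm), hi,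
        gossip_ord.2 ⟨x, y, hx', hy', hxy⟩⟩

end Merge

/-- After `e`, the last event of each participant is `e`, so its row of the table lists the last
events in `Iic e`. The rows of the other processes do not change. -/
theorem update_gossip_Iio (t : Trace D) (e : t.E) :
    Gossip.update D (t.label e) (t.gossip (LowerSet.Iio e)) = t.gossip (LowerSet.Iic e) := by
  unfold Gossip.update
  conv_rhs => rw [gossip]
  rw [Gossip.mk.injEq]
  constructor
  · funext ⟨k, m⟩
    by_cases hk : k ∈ D.loc (t.label e)
    · rw [if_pos hk, last₂, last_Iic_of_mem hk, Option.bind_some]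
      by_cases hm : m ∈ D.loc (t.label e)
      · rw [if_pos hm, last_Iic_of_mem hm, Option.map_some, Trace.tag, stamp_eq]
        simp only [gossip, Option.map_map]
        rfl
      · rw [if_neg hm, last_Iic_of_notMem hm, gossip_tag_self]
    · rw [if_neg hk, last₂, last_Iic_of_notMem hk]
      rfl
  · funext ⟨k, l⟩
    by_cases hl : l ∈ D.loc (t.label e)
    · refine (if_pos hl).trans (decide_eq_decide.2 ?_)
      simp only [isLast_Iic_of_mem hl, gossip_ord_self]
      by_cases hk : k ∈ D.loc (t.label e)
      · simp [isLast_Iic_of_mem hk, hk]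
      · simp only [hk, false_or, isLast_Iic_of_notMem hk]
        exact ⟨fun ⟨x, hx⟩ => ⟨x, e, hx, rfl, le_of_lt hx.1.1⟩, fun ⟨x, _, hx, _⟩ => ⟨x, hx⟩⟩
    · refine (if_neg hl).trans (decide_eq_decide.2 ?_)
      simp only [isLast_Iic_of_notMem hl, gossip_ord]
      by_cases hk : k ∈ D.loc (t.label e)
      · simp only [isLast_Iic_of_mem hk, hk, not_true, false_and, false_iff]
        -- The last event of a process outside `e` is strictly below `e`.
        rintro ⟨x, y, rfl, hy, hxy⟩
        exact (LowerSet.mem_Iio_iff.1 hy.1.1).not_ge hxy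
      · simp only [hk, not_false_eq_true, true_and, isLast_Iic_of_notMem hk]

theorem merge_gossip_strictPast (t : Trace D) (e : t.E) :
    Gossip.merge (fun j : D.loc (t.label e) => t.gossip (t.view (LowerSet.Iio e) j)) =
      t.gossip (LowerSet.Iio e) :=
  Trace.merge_gossip_view (fun _ hf => t.exists_mem_view_Iio hf) (D.loc_nonempty _)

end Trace

/-! ### The gossip transducer. -/

variable [Finite P] [Finite α]

/-- The gossip automaton, with the order of the last events of the processes as output. -/
noncomputable def gossipTransducer (D : DistAlphabet P α) :
    Transducer D (PrimaryLabel P) where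
  S _ := Gossip P α
  δ a x _ := (Gossip.merge x).update D a
  init _ := ⟨fun _ => none, fun _ => false⟩
  out _ x := (Gossip.merge x).ord

theorem gossipTransducer_run (t : Trace D) (c : LowerSet t.E) :
    (gossipTransducer D).run (t.restrict c) = fun i => t.gossip (t.view c i) := by
  refine (gossipTransducer D).run_eq_of_recursion t (fun c i => t.gossip (t.view c i)) ?_ ?_ c
  · intro c i h
    have hn : ∀ k x, ¬ t.IsLast ⊥ k x := fun k x hx => hx.1.1
    have hl : ∀ k, t.last ⊥ k = none := fun k => Trace.last_eq_none.2 fun f hf => hf.elim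
    simp [Trace.view_eq_bot h, Trace.gossip, gossipTransducer, hn, hl, Trace.last₂]
  · intro c i f h
    -- The view after `f` is the merged view of its participants before `f`, extended by `f`.
    rw [h.view_eq, ← t.update_gossip_Iio f, ← t.merge_gossip_strictPast f]
    rfl

theorem gossipTransducer_computes (D : DistAlphabet P α) :
    (gossipTransducer D).Computes (primaryOrder D) := by
  refine Transducer.computes_of_labelling_eq ?_
  funext t e
  change (Gossip.merge (restrictState (D.loc (t.label e))
    ((gossipTransducer D).run (t.restrict (LowerSet.Iio e))))).ord = _
  rw [gossipTransducer_run]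
  exact congrArg Gossip.ord (t.merge_gossip_strictPast e)

end

theorem theorem7 {P α : Type u} [Finite P] [Finite α] (D : DistAlphabet P α) :
    (∃ G : Transducer D (PrimaryLabel P), G.Computes (primaryOrder D)) ∧
    ∀ G : Transducer D (PrimaryLabel P), G.Computes (primaryOrder D) →
      ∀ {Λ : Type u} (s : GlobalCascadeSeq D Λ),
        (s.transducer G).Computes s.globalLabelling := by
  exact ⟨⟨gossipTransducer D, gossipTransducer_computes D⟩,
    fun G hG _ s => s.transducer_computes G hG⟩
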